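/- \textbf{Theorem (Adequacy).} For every quantum program statement $\mathtt{stm}$ and every expectation $f:\mathtt{St}\to\mathbb{R}^{+\infty}=[0,\infty]$ we have $\mathrm{qwp}[\mathtt{stm}](f)=\mathrm{qet}[\mathtt{stm}]\{f\}$ as functions $\mathtt{St}\to\mathbb{R}^{+\infty}$, where the notions are as follows. \emph{Programs.} Fix a set of Boolean variables, a set of number variables, qubits $q_1,\dots,q_n$, and a set of quantum gates $\mathtt{U}$, each with an arity and an associated unitary matrix $U$. Statements are $$\mathtt{skip}\mid x:=e\mid \mathtt{stm}_1;\mathtt{stm}_2\mid \mathtt{if}\ b\ \mathtt{then}\ \mathtt{stm}_1\ \mathtt{else}\ \mathtt{stm}_0\mid \mathtt{while}\ b\ \mathtt{do}\ \mathtt{stm}\mid \bar q \mathrel{*}= \mathtt{U}\mid x:=\mathtt{meas}\ q_i,$$ where $e$ is an expression of the type of $x$ (in a measurement, $x$ is Boolean), $b$ is a Boolean expression, and $\bar q$ is a sequence of distinct qubits. Number expressions are built from number variables and constants in $\mathbb{N}$ with $+$, truncated $-$ and $\times$; Boolean expressions from Boolean variables, $\mathtt{tt}$, $\mathtt{ff}$,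 and $=$ and $<$ between number expressions, with $\neg,\wedge,\vee$. \emph{States.} $\mathtt{St}$ is the set of pairs $(s,\rho)$ of a store $s$ (assigning to Boolean variables values in $\{0,1\}$ and to number variables values in $\mathbb{N}$) and a density operator $\rho$ on $(\mathbb{C}^2)^{\otimes n}$ (a positive semi-definite matrix of trace $1$). $[\![e]\!]_s$ is the value of $e$ in $s$. Let $\Phi_{U_{\bar q}}(\rho)=U_{\bar q}\rho U_{\bar q}^\dagger$, where $U_{\bar q}$ is $U$ acting on $\bar q$ and the identity on the other qubits. Let $M_{0,i}=I_{2^{i-1}}\otimes|0\rangle\langle 0|\otimes I_{2^{n-i}}$, $M_{1,i}=I-M_{0,i}$, $p_{k,i}(\rho)=\mathrm{tr}(M_{k,i}\rho M_{k,i}^\dagger)=\mathrm{tr}(M_{k,i}\rho)$, and let $m_{k,i}(\rho)=M_{k,i}\rho M_{k,i}^\dagger/\mathrm{tr}(M_{k,i}\rho)$ if $\mathrm{tr}(M_{k,i}\rho)\neq 0$ and $m_{k,i}(\rho)=I/2^n$ otherwise. \emph{Operational side.} A probabilistic abstract reduction system (PARS) on a set $A$ is a relation $\to$ between elements of $A$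 and discrete subdistributions on $A$. It is deterministic if every $a$ has at most one $\delta$ with $a\to\delta$; $a$ is terminal if it has none. Write $\{1:a\}$ for the Dirac distribution at $a$. The PARS lifts to subdistributions by the rules: $\{1:a\}\overset{0}{\twoheadrightarrow}\{1:a\}$ if $a$ is terminal; $\{1:a\}\overset{1}{\twoheadrightarrow}\delta$ if $a\to\delta$; and $\sum_i p_i\delta_i\overset{\sum_i p_ic_i}{\twoheadrightarrow}\sum_i p_i\varepsilon_i$ for countable families with $\delta_i\overset{c_i}{\twoheadrightarrow}\varepsilon_i$ for all $i$ and $\sum_i p_i\le 1$. For a deterministic PARS, each $a$ has exactly one infinite reduction $\{1:a\}=\delta_0\twoheadrightarrow\delta_1\twoheadrightarrow\cdots$. The terminal distribution $\mathrm{nf}(a)$ of $a$ is the subdistribution that gives each terminal $b$ the probability $\lim_i\delta_i(b)$ and each non-terminal $b$ the probability $0$. The semantics of programs is the deterministic PARS on configurations $(\mathtt{stm},s,\rho)$, where $\mathtt{stm}$ is a statement or the termination symbol $\downarrow$, given by \begin{itemize} \item $(\mathtt{skip},s,\rho)\to\{1:(\downarrow,s,\rho)\}$; \item $(x:=e,s,\rho)\to\{1:(\downarrow,s[x:=[\![e]\!]_s],\rho)\}$;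 \item $(\bar q \mathrel{*}= \mathtt{U},s,\rho)\to\{1:(\downarrow,s,\Phi_{U_{\bar q}}(\rho))\}$; \item $(x:=\mathtt{meas}\ q_i,s,\rho)\to\{\mathrm{tr}(M_{k,i}\rho):(\downarrow,s[x:=k],m_{k,i}(\rho))\}_{k\in\{0,1\}}$; \item if $(\mathtt{stm}_1,s,\rho)\to\{p_j:(\mathtt{stm}^j,s^j,\rho^j)\}_{j}$ then $(\mathtt{stm}_1;\mathtt{stm}_2,s,\rho)\to\{p_j:(\mathtt{stm}^j;\mathtt{stm}_2,s^j,\rho^j)\}_{j}$, where $\downarrow;\mathtt{stm}_2$ means $\mathtt{stm}_2$; \item $(\mathtt{if}\ b\ \mathtt{then}\ \mathtt{stm}_1\ \mathtt{else}\ \mathtt{stm}_0,s,\rho)\to\{1:(\mathtt{stm}_{[\![b]\!]_s},s,\rho)\}$; \item $(\mathtt{while}\ b\ \mathtt{do}\ \mathtt{stm},s,\rho)\to\{1:(\downarrow,s,\rho)\}$ if $[\![b]\!]_s=0$, and $\to\{1:(\mathtt{stm};\mathtt{while}\ b\ \mathtt{do}\ \mathtt{stm},s,\rho)\}$ if $[\![b]\!]_s=1$.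 \end{itemize} Its terminal objects are the configurations $(\downarrow,s,\rho)$, and $$\mathrm{qwp}[\mathtt{stm}](f)(\sigma)=\sum_{\tau\in\mathtt{St}}\mathrm{nf}(\mathtt{stm},\sigma)(\downarrow,\tau)\cdot f(\tau).$$ \emph{Denotational side.} For $p:\mathtt{St}\to[0,1]$ let $f+_pg=p\cdot f+(1-p)\cdot g$ (pointwise, with $0\cdot\infty=0$). The quantum expectation transformer is defined by recursion on statements: \begin{align*} \mathrm{qet}[\mathtt{skip}]\{f\}&=f,\\ \mathrm{qet}[x:=e]\{f\}(s,\rho)&=f(s[x:=[\![e]\!]_s],\rho),\\ \mathrm{qet}[\mathtt{stm}_1;\mathtt{stm}_2]\{f\}&=\mathrm{qet}[\mathtt{stm}_1]\{\mathrm{qet}[\mathtt{stm}_2]\{f\}\},\\ \mathrm{qet}[\mathtt{if}\ b\ \mathtt{then}\ \mathtt{stm}_1\ \mathtt{else}\ \mathtt{stm}_0]\{f\}&=\mathrm{qet}[\mathtt{stm}_1]\{f\}+_{[\![b]\!]}\mathrm{qet}[\mathtt{stm}_0]\{f\},\\ \mathrm{qet}[\mathtt{while}\ b\ \mathtt{do}\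 \mathtt{stm}]\{f\}&=\mathrm{lfp}\big(\lambda F.\ \mathrm{qet}[\mathtt{stm}]\{F\}+_{[\![b]\!]}f\big),\\ \mathrm{qet}[\bar q \mathrel{*}= \mathtt{U}]\{f\}(s,\rho)&=f(s,\Phi_{U_{\bar q}}(\rho)),\\ \mathrm{qet}[x:=\mathtt{meas}\ q_i]\{f\}&=f_0+_{p_{0,i}}f_1,\qquad f_k(s,\rho)=f(s[x:=k],m_{k,i}(\rho)), \end{align*} where $[\![b]\!]$ is the function $(s,\rho)\mapsto[\![b]\!]_s\in\{0,1\}$, $p_{0,i}$ is regarded as the function $(s,\rho)\mapsto p_{0,i}(\rho)$, and $\mathrm{lfp}$ is the least fixed point for the pointwise order on $\mathtt{St}\to\mathbb{R}^{+\infty}$. -/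

import Mathlib

open scoped ENNReal ComplexOrder Kronecker Matrix
open Filter Topology

noncomputable section

/-! ## Discrete subdistributions -/

/-- Subdistributions on `A`: functions with values in `[0,1]` and total mass at most `1`. Countability
of the support is automatic, see `SubDist.countable_support`. -/
@[ext]
structure SubDist (A : Type*) where
  prob : A → ℝ≥0∞
  tsum_prob_le_one : ∑' a, prob a ≤ 1

namespace SubDist

theorem prob_le_one {A : Type*} (δ : SubDist A) (a : A) : δ.prob a ≤ 1 :=
  (ENNReal.le_tsum a).trans δ.tsum_prob_le_one

theorem countable_support {A : Type*} (δ : SubDist A) : (Function.support δ.prob).Countable :=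
  Summable.countable_support_ennreal (ne_top_of_le_ne_top ENNReal.one_ne_top δ.tsum_prob_le_one)

open Classical in
/-- The Dirac distribution `{1 : a}`. -/
def dirac {A : Type*} (a : A) : SubDist A where
  prob := Pi.single a 1
  tsum_prob_le_one := by rw [tsum_pi_single]

/-- The convex combination `∑ i, p i · δ i`, where `∑ i, p i ≤ 1`. -/
def comb {A ι : Type*} (p : ι → ℝ≥0∞) (hp : ∑' i, p i ≤ 1) (δ : ι → SubDist A) : SubDist A where
  prob a := ∑' i, p i * (δ i).prob a
  tsum_prob_le_one := by
    rw [ENNReal.tsum_comm]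
    refine le_trans (ENNReal.tsum_le_tsum fun i => ?_) hp
    rw [ENNReal.tsum_mul_left]
    exact mul_le_of_le_one_right' (δ i).tsum_prob_le_one

/-- The image `{δ a : g a}` of `δ` under `g`. -/
def map {A A' : Type*} (g : A → A') (δ : SubDist A) : SubDist A' :=
  comb δ.prob δ.tsum_prob_le_one fun a => dirac (g a)

/-- The expectation `𝔼_δ(f) = ∑ a, δ(a) f(a)`. -/
def expect {A : Type*} (δ : SubDist A) (f : A → ℝ≥0∞) : ℝ≥0∞ := ∑' a, δ.prob a * f a

theorem comb_dirac_left {A A' : Type*} (a : A) (h) (κ : A → SubDist A') :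
    comb (dirac a).prob h κ = κ a := by
  classical
  ext b
  change ∑' i, (dirac a).prob i * (κ i).prob b = _
  rw [tsum_eq_single a]
  · simp [dirac]
  · intro c hc
    simp [dirac, Pi.single_eq_of_ne hc]

theorem comb_comb {A A' ι : Type*} (p : ι → ℝ≥0∞) (hp : ∑' i, p i ≤ 1) (δ : ι → SubDist A)
    (κ : A → SubDist A') (h) :
    comb (comb p hp δ).prob h κ
      = comb p hp fun i => comb (δ i).prob (δ i).tsum_prob_le_one κ := by
  ext b
  change ∑' a, (∑' i, p i * (δ i).prob a) * (κ a).prob b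
    = ∑' i, p i * ∑' a, (δ i).prob a * (κ a).prob b
  simp_rw [← ENNReal.tsum_mul_right, ← ENNReal.tsum_mul_left]
  rw [ENNReal.tsum_comm]
  simp_rw [mul_assoc]

end SubDist

/-! ## Probabilistic abstract reduction systems -/

/-- A PARS on `A` is a binary relation between `A` and the subdistributions on `A`. -/
abbrev PARS (A : Type*) := A → SubDist A → Prop

namespace PARS

def Deterministic {A : Type*} (R : PARS A) : Prop :=
  ∀ a δ₁ δ₂, R a δ₁ → R a δ₂ → δ₁ = δ₂

def Terminal {A : Type*} (R : PARS A) (a : A) : Prop := ∀ δ, ¬ R a δ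

/-- The lifting of a PARS to a weighted reduction relation on subdistributions. -/
inductive Lift {A : Type*} (R : PARS A) : SubDist A → ℝ≥0∞ → SubDist A → Prop
  | terminal {a : A} (h : R.Terminal a) : Lift R (.dirac a) 0 (.dirac a)
  | step {a : A} {δ : SubDist A} (h : R a δ) : Lift R (.dirac a) 1 δ
  | sum {ι : Type} [Countable ι] (p : ι → ℝ≥0∞) (hp : ∑' i, p i ≤ 1) (δ ε : ι → SubDist A)
      (c : ι → ℝ≥0∞) (h : ∀ i, Lift R (δ i) (c i) (ε i)) :
      Lift R (.comb p hp δ) (∑' i, p i * c i) (.comb p hp ε)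

/-- `δ` is an infinite reduction `{1 : a} = δ 0 ⇝ δ 1 ⇝ δ 2 ⇝ ⋯`, with weights `c`. -/
def IsReduction {A : Type*} (R : PARS A) (a : A) (δ : ℕ → SubDist A) (c : ℕ → ℝ≥0∞) : Prop :=
  δ 0 = .dirac a ∧ ∀ i, Lift R (δ i) (c i) (δ (i + 1))

/-- `ν` is the terminal distribution of `a`: for terminal `b`, `ν(b)` is the limit of the
probabilities of `b` along an infinite reduction from `a`; non-terminal objects have probability
`0` in `ν`. -/
def IsTerminalDist {A : Type*} (R : PARS A) (a : A) (ν : SubDist A) : Prop :=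
  ∃ δ c, R.IsReduction a δ c ∧
    (∀ b, R.Terminal b → Tendsto (fun i => (δ i).prob b) atTop (𝓝 (ν.prob b))) ∧
    (∀ b, ¬ R.Terminal b → ν.prob b = 0)

open Classical in
/-- Auxiliary: the one-step reduct of `a`, which is `{1 : a}` if `a` is terminal. -/
def next {A : Type*} (R : PARS A) (a : A) : SubDist A :=
  if h : ∃ δ, R a δ then h.choose else .dirac a

theorem next_of_terminal {A : Type*} {R : PARS A} {a : A} (h : R.Terminal a) :
    R.next a = .dirac a := by
  have h' : ¬ ∃ δ, R a δ := fun ⟨δ, hδ⟩ => h δ hδ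
  simp [next, h']

theorem next_of_step {A : Type*} {R : PARS A} (hR : R.Deterministic) {a : A} {δ : SubDist A}
    (h : R a δ) : R.next a = δ := by
  have h' : ∃ δ, R a δ := ⟨δ, h⟩
  rw [next, dif_pos h']
  exact hR _ _ _ h'.choose_spec h

theorem Lift.eq_comb_next {A : Type*} {R : PARS A} (hR : R.Deterministic) {δ ε : SubDist A}
    {c : ℝ≥0∞} (h : Lift R δ c ε) : ε = .comb δ.prob δ.tsum_prob_le_one R.next := by
  induction h with
  | terminal h => rw [SubDist.comb_dirac_left, next_of_terminal h]
  | step h => rw [SubDist.comb_dirac_left, next_of_step hR h]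
  | sum p hp δ ε c h ih =>
    rw [SubDist.comb_comb]
    congr 1
    exact funext ih

theorem exists_lift {A : Type*} (R : PARS A) (δ : SubDist A) :
    ∃ c, Lift R δ c (.comb δ.prob δ.tsum_prob_le_one R.next) := by
  classical
  have hone : ∀ a, ∃ c, Lift R (.dirac a) c (R.next a) := by
    intro a
    by_cases h : ∃ δ, R a δ
    · refine ⟨1, .step ?_⟩
      rw [next, dif_pos h]
      exact h.choose_spec
    · have h' : R.Terminal a := fun δ hδ => h ⟨δ, hδ⟩
      rw [next_of_terminal h']
      exact ⟨0, .terminal h'⟩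
  choose w hw using hone
  have : Countable (Function.support δ.prob) := δ.countable_support.to_subtype
  let e := (equivShrink.{0} (Function.support δ.prob)).symm
  have key : ∀ g : A → ℝ≥0∞, ∑' i, δ.prob (e i) * g (e i) = ∑' a, δ.prob a * g a := by
    intro g
    rw [e.tsum_eq (fun x : Function.support δ.prob => δ.prob x * g x)]
    refine tsum_subtype_eq_of_support_subset (f := fun a => δ.prob a * g a) ?_
    intro a ha h0
    exact ha (by simp [h0])
  have hp : ∑' i, δ.prob (e i) ≤ 1 := by
    have := key fun _ => 1
    simp only [mul_one] at this
    rw [this]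
    exact δ.tsum_prob_le_one
  have : Countable (Shrink.{0} (Function.support δ.prob)) := e.countable_iff.2 inferInstance
  have h := Lift.sum (R := R) (fun i => δ.prob (e i)) hp (fun i => .dirac (e i).1)
    (fun i => R.next (e i)) (fun i => w (e i)) fun i => hw _
  have h1 : SubDist.comb (fun i => δ.prob (e i)) hp (fun i => .dirac (e i).1) = δ := by
    ext b
    refine (key fun a => (SubDist.dirac a).prob b).trans ?_
    rw [tsum_eq_single b]
    · simp [SubDist.dirac]
    · intro a hab
      simp [SubDist.dirac, Pi.single_eq_of_ne hab.symm]
  have h2 : SubDist.comb (fun i => δ.prob (e i)) hp (fun i => R.next (e i))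
      = .comb δ.prob δ.tsum_prob_le_one R.next := by
    ext b
    exact key fun a => (R.next a).prob b
  rw [h1, h2] at h
  exact ⟨_, h⟩

/-- Auxiliary: the infinite reduction from `a`. -/
def reduction {A : Type*} (R : PARS A) (a : A) : ℕ → SubDist A
  | 0 => .dirac a
  | i + 1 => .comb (reduction R a i).prob (reduction R a i).tsum_prob_le_one R.next

theorem IsReduction.eq_reduction {A : Type*} {R : PARS A} (hR : R.Deterministic) {a : A}
    {δ : ℕ → SubDist A} {c : ℕ → ℝ≥0∞} (h : R.IsReduction a δ c) : δ = R.reduction a := by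
  funext i
  induction i with
  | zero => exact h.1
  | succ i ih => rw [(h.2 i).eq_comb_next hR, reduction, ih]

theorem exists_isReduction {A : Type*} (R : PARS A) (a : A) :
    ∃ c, R.IsReduction a (R.reduction a) c := by
  choose c hc using fun i => R.exists_lift (R.reduction a i)
  exact ⟨c, rfl, hc⟩

theorem monotone_reduction {A : Type*} {R : PARS A} (a : A) {b : A} (hb : R.Terminal b) :
    Monotone fun i => (R.reduction a i).prob b := by
  classical
  refine monotone_nat_of_le_succ fun i => ?_
  change _ ≤ ∑' x, (R.reduction a i).prob x * (R.next x).prob b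
  refine le_trans ?_ (ENNReal.le_tsum b)
  rw [next_of_terminal hb]
  simp [SubDist.dirac]

/-- In a deterministic PARS, every object has exactly one terminal distribution. -/
theorem existsUnique_terminalDist {A : Type*} (R : PARS A) (hR : R.Deterministic) (a : A) :
    ∃! ν, R.IsTerminalDist a ν := by
  classical
  obtain ⟨c, hc⟩ := R.exists_isReduction a
  let g : A → ℝ≥0∞ := fun b => if R.Terminal b then ⨆ i, (R.reduction a i).prob b else 0
  have hg : ∀ b, R.Terminal b → Tendsto (fun i => (R.reduction a i).prob b) atTop (𝓝 (g b)) := by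
    intro b hb
    simp only [g, if_pos hb]
    exact tendsto_atTop_iSup (monotone_reduction a hb)
  have hle : ∑' b, g b ≤ 1 := by
    rw [ENNReal.tsum_eq_iSup_sum]
    refine iSup_le fun s => ?_
    have ht : Tendsto (fun i => ∑ b ∈ s, if R.Terminal b then (R.reduction a i).prob b else 0)
        atTop (𝓝 (∑ b ∈ s, g b)) := by
      refine tendsto_finsetSum _ fun b _ => ?_
      by_cases hb : R.Terminal b
      · simpa only [if_pos hb] using hg b hb
      · simp [g, hb]
    refine le_of_tendsto' ht fun i => ?_
    refine le_trans (Finset.sum_le_sum fun b _ => ?_)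
      ((ENNReal.sum_le_tsum s).trans (R.reduction a i).tsum_prob_le_one)
    split_ifs <;> simp
  refine ⟨⟨g, hle⟩, ⟨_, c, hc, hg, fun b hb => by simp [g, hb]⟩, ?_⟩
  rintro ν ⟨δ, c', hred, hlim, hzero⟩
  ext b
  by_cases hb : R.Terminal b
  · have h1 := hlim b hb
    rw [hred.eq_reduction hR] at h1
    exact tendsto_nhds_unique h1 (hg b hb)
  · simp [hzero b hb, g, hb]

/-- The terminal distribution of `a` in a deterministic PARS. -/
def nf {A : Type*} (R : PARS A) (hR : R.Deterministic) (a : A) : SubDist A :=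
  (R.existsUnique_terminalDist hR a).choose

theorem isTerminalDist_nf {A : Type*} (R : PARS A) (hR : R.Deterministic) (a : A) :
    R.IsTerminalDist a (R.nf hR a) :=
  (R.existsUnique_terminalDist hR a).choose_spec.1

/-- The weakest pre-expectation of a deterministic PARS. -/
def wp {A : Type*} (R : PARS A) (hR : R.Deterministic) (f : A → ℝ≥0∞) (a : A) : ℝ≥0∞ :=
  (R.nf hR a).expect f

end PARS

namespace QProg

/-! ## Syntax -/

inductive NExp (V : Type*)
  | var (x : V)
  | const (k : ℕ)
  | add (e₁ e₂ : NExp V)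
  | sub (e₁ e₂ : NExp V)
  | mul (e₁ e₂ : NExp V)

inductive BExp (B V : Type*)
  | var (x : B)
  | tt
  | ff
  | eq (e₁ e₂ : NExp V)
  | lt (e₁ e₂ : NExp V)
  | not (b : BExp B V)
  | and (b₁ b₂ : BExp B V)
  | or (b₁ b₂ : BExp B V)

/-- A set of quantum gates: gate symbols, each with an arity and a unitary matrix on the computational
basis of that many qubits. -/
structure GateSet where
  Gate : Type*
  arity : Gate → ℕ
  mat : (g : Gate) → Matrix.unitaryGroup (Fin (arity g) → Bool) ℂ

/-- Statements over the gates `G`, the Boolean variables `B`, the number variables `V` and the qubits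
`q₁, …, qₙ` (indexed by `Fin n`). A gate acts on a sequence of pairwise distinct qubits. -/
inductive Stmt (G : GateSet) (B V : Type*) (n : ℕ)
  | skip
  | assignB (x : B) (e : BExp B V)
  | assignN (x : V) (e : NExp V)
  | seq (c₁ c₂ : Stmt G B V n)
  | ite (b : BExp B V) (c₁ c₂ : Stmt G B V n)
  | loop (b : BExp B V) (c : Stmt G B V n)
  | apply (g : G.Gate) (q : Fin (G.arity g) ↪ Fin n)
  | meas (x : B) (i : Fin n)

/-! ## Classical and quantum states -/

/-- Well-typed stores: Boolean variables have values in `{0, 1}`, number variables in `ℕ`. -/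
structure Store (B V : Type*) where
  bool : B → Bool
  num : V → ℕ

open Classical in
def Store.setB {B V : Type*} (s : Store B V) (x : B) (k : Bool) : Store B V :=
  { s with bool := Function.update s.bool x k }

open Classical in
def Store.setN {B V : Type*} (s : Store B V) (x : V) (k : ℕ) : Store B V :=
  { s with num := Function.update s.num x k }

/-- Subtraction is truncated at `0`. -/
def NExp.eval {B V : Type*} (s : Store B V) : NExp V → ℕ
  | var x => s.num x
  | const k => k
  | add e₁ e₂ => e₁.eval s + e₂.eval s
  | sub e₁ e₂ => e₁.eval s - e₂.eval s
  | mul e₁ e₂ => e₁.eval s * e₂.eval s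

def BExp.eval {B V : Type*} (s : Store B V) : BExp B V → Bool
  | var x => s.bool x
  | tt => true
  | ff => false
  | eq e₁ e₂ => decide (e₁.eval s = e₂.eval s)
  | lt e₁ e₂ => decide (e₁.eval s < e₂.eval s)
  | not b => !(b.eval s)
  | and b₁ b₂ => b₁.eval s && b₂.eval s
  | or b₁ b₂ => b₁.eval s || b₂.eval s

/-- Complex matrices on the `2 ^ n`-dimensional space of `n` qubits, in the computational basis, which
is indexed by `Fin n → Bool` (`false` for `|0⟩`, `true` for `|1⟩`). -/
abbrev QMat (n : ℕ) := Matrix (Fin n → Bool) (Fin n → Bool) ℂ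

/-- Density operators: positive semi-definite matrices of trace `1`. -/
def Density (n : ℕ) := {ρ : QMat n // ρ.PosSemidef ∧ ρ.trace = 1}

/-- The extension of an `m`-qubit matrix `U` to all `n` qubits: `U` acts on the qubits listed in `q`,
the identity acts on the others. -/
def extend {m n : ℕ} (U : QMat m) (q : Fin m ↪ Fin n) : QMat n :=
  open Classical in
  fun x y => if ∀ j, j ∉ Set.range q → x j = y j then U (x ∘ q) (y ∘ q) else 0

open Classical in
theorem extend_mem_unitary {m n : ℕ} (U : QMat m) (hU : U ∈ Matrix.unitaryGroup (Fin m → Bool) ℂ)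
    (q : Fin m ↪ Fin n) : extend U q ∈ Matrix.unitaryGroup (Fin n → Bool) ℂ := by
  let e₁ : (Fin n → Bool) ≃ _ := Equiv.piEquivPiSubtypeProd (fun j => j ∈ Set.range q) fun _ => Bool
  let e₂ : ({j // j ∈ Set.range q} → Bool) ≃ (Fin m → Bool) :=
    Equiv.arrowCongr (Equiv.ofInjective q q.injective).symm (Equiv.refl _)
  let e := e₁.trans (Equiv.prodCongr e₂ (Equiv.refl ({j // j ∉ Set.range q} → Bool)))
  have h : extend U q
      = (U ⊗ₖ (1 : Matrix ({j // j ∉ Set.range q} → Bool) ({j // j ∉ Set.range q} → Bool) ℂ)).submatrix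
        e e := by
    ext x y
    have hx : ∀ z, (e z).1 = z ∘ q := fun z => rfl
    have hz : ∀ z, (e z).2 = fun j => z j.1 := fun z => rfl
    simp only [Matrix.submatrix_apply, Matrix.kroneckerMap_apply, Matrix.one_apply, hx, hz, extend]
    by_cases hxy : ∀ j, j ∉ Set.range q → x j = y j
    · have h2 : (fun j : {j // j ∉ Set.range q} => x j.1) = fun j => y j.1 :=
        funext fun j => hxy j.1 j.2
      exact (if_pos hxy).trans ((mul_one _).symm.trans (congrArg _ (if_pos h2).symm))
    · have h2 : ¬ (fun j : {j // j ∉ Set.range q} => x j.1) = fun j => y j.1 :=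
        fun hj => hxy fun j hjq => congrFun hj ⟨j, hjq⟩
      exact (if_neg hxy).trans ((mul_zero _).symm.trans (congrArg _ (if_neg h2).symm))
  have hk := Matrix.kronecker_mem_unitary hU
    (one_mem (Matrix.unitaryGroup ({j // j ∉ Set.range q} → Bool) ℂ))
  rw [Matrix.mem_unitaryGroup_iff] at hk ⊢
  rw [h, Matrix.star_eq_conjTranspose, Matrix.conjTranspose_submatrix, Matrix.submatrix_mul_equiv,
    ← Matrix.star_eq_conjTranspose, hk, Matrix.submatrix_one_equiv]

/-- The superoperator `ρ ↦ U ρ U†`. -/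
def Density.conj {n : ℕ} (U : Matrix.unitaryGroup (Fin n → Bool) ℂ) (ρ : Density n) : Density n :=
  ⟨U.1 * ρ.1 * U.1ᴴ, ρ.2.1.mul_mul_conjTranspose_same U.1, by
    rw [Matrix.trace_mul_cycle, ← Matrix.star_eq_conjTranspose,
      Matrix.mem_unitaryGroup_iff'.1 U.2, one_mul, ρ.2.2]⟩

/-- The superoperator of a gate, applied to the qubits listed in `q`. -/
def gateOp {G : GateSet} {n : ℕ} (g : G.Gate) (q : Fin (G.arity g) ↪ Fin n) :
    Density n → Density n :=
  Density.conj ⟨extend (G.mat g).1 q, extend_mem_unitary _ (G.mat g).2 q⟩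

/-- The measurement operators: for outcome `0`, the matrix `I ⊗ |0⟩⟨0| ⊗ I`, with `|0⟩⟨0|` at qubit `i`;
for outcome `1`, its complement. -/
def measMat {n : ℕ} : Bool → Fin n → QMat n
  | false, i => Matrix.diagonal fun x => if x i = false then 1 else 0
  | true, i => 1 - Matrix.diagonal fun x => if x i = false then 1 else 0

theorem measMat_eq {n : ℕ} (k : Bool) (i : Fin n) :
    measMat k i = Matrix.diagonal fun x => if x i = k then 1 else 0 := by
  cases k
  · rfl
  · rw [measMat, ← Matrix.diagonal_one, Matrix.diagonal_sub]
    congr 1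
    funext x
    cases h : x i <;> simp

theorem measMat_conjTranspose_mul_self {n : ℕ} (k : Bool) (i : Fin n) :
    (measMat k i)ᴴ * measMat k i = measMat k i := by
  rw [measMat_eq, Matrix.diagonal_conjTranspose, Matrix.diagonal_mul_diagonal]
  congr 1
  funext x
  by_cases h : x i = k <;> simp [h]

theorem trace_measMat_conj {n : ℕ} (k : Bool) (i : Fin n) (ρ : QMat n) :
    (measMat k i * ρ * (measMat k i)ᴴ).trace = (measMat k i * ρ).trace := by
  rw [Matrix.trace_mul_cycle, measMat_conjTranspose_mul_self]

theorem trace_measMat_nonneg {n : ℕ} (k : Bool) (i : Fin n) (ρ : Density n) :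
    0 ≤ (measMat k i * ρ.1).trace := by
  rw [← trace_measMat_conj]
  exact (ρ.2.1.mul_mul_conjTranspose_same _).trace_nonneg

/-- The probability `tr(M ρ)` of the outcome `k` when qubit `i` is measured. -/
def measProb {n : ℕ} (k : Bool) (i : Fin n) (ρ : Density n) : ℝ≥0∞ :=
  ENNReal.ofReal (measMat k i * ρ.1).trace.re

theorem tsum_measProb {n : ℕ} (i : Fin n) (ρ : Density n) : ∑' k, measProb k i ρ = 1 := by
  rw [tsum_bool, measProb, measProb, ← ENNReal.ofReal_add (Complex.le_def.1 (trace_measMat_nonneg _ i ρ)).1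
    (Complex.le_def.1 (trace_measMat_nonneg _ i ρ)).1, ← Complex.add_re, ← Matrix.trace_add,
    ← Matrix.add_mul, measMat, measMat, add_sub_cancel, one_mul, ρ.2.2]
  simp

theorem posSemidef_maxMixed (n : ℕ) :
    (((2 : ℂ) ^ n)⁻¹ • (1 : QMat n)).PosSemidef ∧ (((2 : ℂ) ^ n)⁻¹ • (1 : QMat n)).trace = 1 := by
  constructor
  · refine Matrix.PosSemidef.one.smul ?_
    positivity
  · rw [Matrix.trace_smul, Matrix.trace_one]
    simp

open Classical in
/-- The normalized state after outcome `k` of a measurement of qubit `i`: `M ρ M† / tr(M ρ)` if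
`tr(M ρ) ≠ 0`, and `I / 2 ^ n` otherwise. -/
def postMeas {n : ℕ} (k : Bool) (i : Fin n) (ρ : Density n) : Density n :=
  if h : (measMat k i * ρ.1).trace ≠ 0 then
    ⟨(measMat k i * ρ.1).trace⁻¹ • (measMat k i * ρ.1 * (measMat k i)ᴴ),
      (ρ.2.1.mul_mul_conjTranspose_same _).smul (inv_nonneg.2 (trace_measMat_nonneg k i ρ)), by
      rw [Matrix.trace_smul, trace_measMat_conj, smul_eq_mul, inv_mul_cancel₀ h]⟩
  else ⟨((2 : ℂ) ^ n)⁻¹ • 1, posSemidef_maxMixed n⟩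

/-! ## Operational semantics -/

/-- States: pairs of a store and a quantum state. -/
abbrev State (B V : Type*) (n : ℕ) := Store B V × Density n

/-- Configurations: pairs of a statement or the termination symbol `↓` (which is `none`), and a
state. -/
abbrev Conf (G : GateSet) (B V : Type*) (n : ℕ) := Option (Stmt G B V n) × State B V n

/-- Sequential composition extended by `↓; c = c`. -/
def seqC {G : GateSet} {B V : Type*} {n : ℕ} (c₁ : Option (Stmt G B V n)) (c₂ : Stmt G B V n) :
    Stmt G B V n :=
  match c₁ with
  | none => c₂
  | some c₁ => .seq c₁ c₂

/-- The reduction rules of quantum programs. -/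
inductive Step {G : GateSet} {B V : Type*} {n : ℕ} : PARS (Conf G B V n)
  | skip (s : Store B V) (ρ : Density n) :
      Step (some .skip, s, ρ) (.dirac (none, s, ρ))
  | assignB (x : B) (e : BExp B V) (s : Store B V) (ρ : Density n) :
      Step (some (.assignB x e), s, ρ) (.dirac (none, s.setB x (e.eval s), ρ))
  | assignN (x : V) (e : NExp V) (s : Store B V) (ρ : Density n) :
      Step (some (.assignN x e), s, ρ) (.dirac (none, s.setN x (e.eval s), ρ))
  | apply (g : G.Gate) (q : Fin (G.arity g) ↪ Fin n) (s : Store B V) (ρ : Density n) :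
      Step (some (.apply g q), s, ρ) (.dirac (none, s, gateOp g q ρ))
  | meas (x : B) (i : Fin n) (s : Store B V) (ρ : Density n) :
      Step (some (.meas x i), s, ρ)
        (.comb (fun k => measProb k i ρ) (tsum_measProb i ρ).le
          fun k => .dirac (none, s.setB x k, postMeas k i ρ))
  | seq (c₁ c₂ : Stmt G B V n) (s : Store B V) (ρ : Density n) (δ : SubDist (Conf G B V n))
      (h : Step (some c₁, s, ρ) δ) :
      Step (some (.seq c₁ c₂), s, ρ) (δ.map fun μ => (some (seqC μ.1 c₂), μ.2))
  | iteTrue (b : BExp B V) (c₁ c₂ : Stmt G B V n) (s : Store B V) (ρ : Density n)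
      (h : b.eval s = true) :
      Step (some (.ite b c₁ c₂), s, ρ) (.dirac (some c₁, s, ρ))
  | iteFalse (b : BExp B V) (c₁ c₂ : Stmt G B V n) (s : Store B V) (ρ : Density n)
      (h : b.eval s = false) :
      Step (some (.ite b c₁ c₂), s, ρ) (.dirac (some c₂, s, ρ))
  | loopFalse (b : BExp B V) (c : Stmt G B V n) (s : Store B V) (ρ : Density n)
      (h : b.eval s = false) :
      Step (some (.loop b c), s, ρ) (.dirac (none, s, ρ))
  | loopTrue (b : BExp B V) (c : Stmt G B V n) (s : Store B V) (ρ : Density n)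
      (h : b.eval s = true) :
      Step (some (.loop b c), s, ρ) (.dirac (some (.seq c (.loop b c)), s, ρ))

theorem step_deterministic {G : GateSet} {B V : Type*} {n : ℕ} :
    (Step (G := G) (B := B) (V := V) (n := n)).Deterministic := by
  intro μ δ₁ δ₂ h₁
  induction h₁ generalizing δ₂ with
  | seq c₁ c₂ s ρ δ h ih =>
    intro h₂
    cases h₂ with
    | seq _ _ _ _ δ' h' => rw [ih _ h']
  | _ =>
    intro h₂
    cases h₂ <;> simp_all

/-- The terminal objects are precisely the configurations `(↓, s, ρ)`. -/
theorem terminal_step_iff {G : GateSet} {B V : Type*} {n : ℕ} (μ : Conf G B V n) :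
    PARS.Terminal Step μ ↔ μ.1 = none := by
  obtain ⟨c, s, ρ⟩ := μ
  constructor
  · intro h
    cases c with
    | none => rfl
    | some c =>
      exfalso
      suffices ∃ δ, Step (some c, s, ρ) δ from this.elim fun δ hδ => h δ hδ
      clear h
      induction c with
      | skip => exact ⟨_, .skip s ρ⟩
      | assignB x e => exact ⟨_, .assignB x e s ρ⟩
      | assignN x e => exact ⟨_, .assignN x e s ρ⟩
      | seq c₁ c₂ ih₁ _ => exact ih₁.elim fun δ hδ => ⟨_, .seq c₁ c₂ s ρ δ hδ⟩
      | ite b c₁ c₂ =>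
        cases hb : b.eval s
        · exact ⟨_, .iteFalse b c₁ c₂ s ρ hb⟩
        · exact ⟨_, .iteTrue b c₁ c₂ s ρ hb⟩
      | loop b c =>
        cases hb : b.eval s
        · exact ⟨_, .loopFalse b c s ρ hb⟩
        · exact ⟨_, .loopTrue b c s ρ hb⟩
      | apply g q => exact ⟨_, .apply g q s ρ⟩
      | meas x i => exact ⟨_, .meas x i s ρ⟩
  · intro h δ hδ
    obtain rfl : c = none := h
    cases hδ

/-- The operational weakest pre-expectation of a statement. -/
def qwp {G : GateSet} {B V : Type*} {n : ℕ} (c : Stmt G B V n) (f : State B V n → ℝ≥0∞) :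
    State B V n → ℝ≥0∞ :=
  fun σ => PARS.wp Step step_deterministic (fun μ => f μ.2) (some c, σ)

/-! ## The quantum expectation transformer -/

/-- `f +_p g = p · f + (1 - p) · g`, for `p` with values in `[0, 1]`. -/
def mix {S : Type*} (p f g : S → ℝ≥0∞) : S → ℝ≥0∞ := fun σ => p σ * f σ + (1 - p σ) * g σ

theorem mix_mono {S : Type*} (p : S → ℝ≥0∞) {f f' g g' : S → ℝ≥0∞} (hf : f ≤ f') (hg : g ≤ g') :
    mix p f g ≤ mix p f' g' := fun σ =>
  add_le_add (mul_le_mul_right (hf σ) _) (mul_le_mul_right (hg σ) _)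

/-- The value of a Boolean expression, seen as a function with values in `{0, 1}`. -/
def guard {B V : Type*} {n : ℕ} (b : BExp B V) : State B V n → ℝ≥0∞ :=
  fun σ => if b.eval σ.1 = true then 1 else 0

/-- The probability `tr(M ρ M†)`, as a function of the state. -/
def outcomeProb {B V : Type*} {n : ℕ} (k : Bool) (i : Fin n) : State B V n → ℝ≥0∞ :=
  fun σ => ENNReal.ofReal (measMat k i * σ.2.1 * (measMat k i)ᴴ).trace.re

/-- The loop functional `F ↦ T F +_b f`. -/
def loopFun {B V : Type*} {n : ℕ} (b : BExp B V)
    (T : (State B V n → ℝ≥0∞) →o (State B V n → ℝ≥0∞)) (f : State B V n → ℝ≥0∞) :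
    (State B V n → ℝ≥0∞) →o (State B V n → ℝ≥0∞) where
  toFun F := mix (guard b) (T F) f
  monotone' _ _ h := mix_mono _ (T.monotone h) le_rfl

/-- The quantum expectation transformer. It is defined together with its monotonicity, so that the
least fixed points of the loop functionals in the complete lattice of expectations (ordered
pointwise) exist. -/
def qet {G : GateSet} {B V : Type*} {n : ℕ} :
    Stmt G B V n → (State B V n → ℝ≥0∞) →o (State B V n → ℝ≥0∞)
  | .skip => OrderHom.id
  | .assignB x e =>
      { toFun := fun f σ => f (σ.1.setB x (e.eval σ.1), σ.2)
        monotone' := fun _ _ h _ => h _ }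
  | .assignN x e =>
      { toFun := fun f σ => f (σ.1.setN x (e.eval σ.1), σ.2)
        monotone' := fun _ _ h _ => h _ }
  | .seq c₁ c₂ => (qet c₁).comp (qet c₂)
  | .ite b c₁ c₂ =>
      { toFun := fun f => mix (guard b) (qet c₁ f) (qet c₂ f)
        monotone' := fun _ _ h => mix_mono _ ((qet c₁).monotone h) ((qet c₂).monotone h) }
  | .loop b c =>
      { toFun := fun f => OrderHom.lfp (loopFun b (qet c) f)
        monotone' := fun _ _ h => OrderHom.lfp.monotone fun _ => mix_mono _ le_rfl h }
  | .apply g q =>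
      { toFun := fun f σ => f (σ.1, gateOp g q σ.2)
        monotone' := fun _ _ h _ => h _ }
  | .meas x i =>
      { toFun := fun f =>
          mix (outcomeProb false i)
            (fun σ => f (σ.1.setB x false, postMeas false i σ.2))
            (fun σ => f (σ.1.setB x true, postMeas true i σ.2))
        monotone' := fun _ _ h => mix_mono _ (fun _ => h _) (fun _ => h _) }

end QProg

end

/-! ### Expectations over subdistributions and monotone convergence. -/

namespace SubDist

/-! `qwp` obeys the recursive equations that define `qet`, so the two agree by induction on the
statement. The analytic input is `PARS.wp_eq_iSup`: the weakest pre-expectation is the increasing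
supremum of its step-bounded approximants `approx`. It turns a statement about limit distributions
into inductions on a number of steps.

Two cases carry the argument. For composition, `qwp_seq` bounds the approximants of `c₁; c₂` by
running `c₁` against the bound for `c₂`; conversely, continuing with `c₂` defines a function on the
configurations of `c₁` whose expectation is preserved by each step, to which `PARS.wp_le` applies.
For loops, `qwp_loop_unfold` makes `qwp` of the loop a fixed point of the loop functional, and
`qwp_loop_le` puts it below every pre-fixed point; hence it is the least fixed point. Only
monotonicity of `qet` is needed, not continuity. -/

theorem expect_mono {A : Type*} (δ : SubDist A) {f g : A → ℝ≥0∞} (h : ∀ a, f a ≤ g a) :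
    δ.expect f ≤ δ.expect g :=
  ENNReal.tsum_le_tsum fun a => mul_le_mul_right (h a) _

theorem expect_comb {A ι : Type*} (p : ι → ℝ≥0∞) (hp : ∑' i, p i ≤ 1) (δ : ι → SubDist A)
    (f : A → ℝ≥0∞) : (comb p hp δ).expect f = ∑' i, p i * (δ i).expect f := by
  change ∑' a, (∑' i, p i * (δ i).prob a) * f a = ∑' i, p i * ∑' a, (δ i).prob a * f a
  simp_rw [← ENNReal.tsum_mul_right, ← ENNReal.tsum_mul_left]
  rw [ENNReal.tsum_comm]
  simp_rw [mul_assoc]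

theorem expect_dirac {A : Type*} (a : A) (f : A → ℝ≥0∞) : (dirac a).expect f = f a := by
  classical
  rw [expect, tsum_eq_single a]
  · simp [dirac]
  · intro b hb
    simp [dirac, Pi.single_eq_of_ne hb]

theorem expect_map {A A' : Type*} (g : A → A') (δ : SubDist A) (f : A' → ℝ≥0∞) :
    (δ.map g).expect f = δ.expect (f ∘ g) := by
  rw [map, expect_comb]
  simp only [expect_dirac]
  rfl

end SubDist

/-- Monotone convergence: an infinite sum in `ℝ≥0∞` is the supremum of its finite subsums, suprema
commute, and a finite sum commutes with increasing suprema. -/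
theorem ENNReal.tsum_iSup_of_monotone {A : Type*} {f : ℕ → A → ℝ≥0∞}
    (hf : ∀ a, Monotone fun k => f k a) : ∑' a, ⨆ k, f k a = ⨆ k, ∑' a, f k a := by
  simp_rw [ENNReal.tsum_eq_iSup_sum]
  rw [iSup_comm]
  exact iSup_congr fun s => ENNReal.finsetSum_iSup_of_monotone hf

namespace SubDist

theorem expect_iSup {A : Type*} (δ : SubDist A) {f : ℕ → A → ℝ≥0∞}
    (hf : ∀ a, Monotone fun k => f k a) :
    δ.expect (fun a => ⨆ k, f k a) = ⨆ k, δ.expect (f k) := by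
  simp only [expect, ENNReal.mul_iSup]
  exact ENNReal.tsum_iSup_of_monotone fun a _ _ h => mul_le_mul_right (hf a h) _

end SubDist

/-! ### Weakest pre-expectations as suprema of step-bounded approximants. -/

namespace PARS

open Classical in
/-- The expectation of `f` over the terminal objects reached from `a` in at most `k` steps. -/
noncomputable def approx {A : Type*} (R : PARS A) (f : A → ℝ≥0∞) : ℕ → A → ℝ≥0∞
  | 0, a => if R.Terminal a then f a else 0
  | k + 1, a => (R.next a).expect (approx R f k)

theorem approx_of_terminal {A : Type*} {R : PARS A} (f : A → ℝ≥0∞) {a : A} (h : R.Terminal a)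
    (k : ℕ) : R.approx f k a = f a := by
  induction k with
  | zero => simp [approx, h]
  | succ k ih => rw [approx, next_of_terminal h, SubDist.expect_dirac, ih]

theorem approx_le_succ {A : Type*} (R : PARS A) (f : A → ℝ≥0∞) (k : ℕ) (a : A) :
    R.approx f k a ≤ R.approx f (k + 1) a := by
  induction k generalizing a with
  | zero =>
    by_cases h : R.Terminal a
    · rw [approx_of_terminal f h, approx_of_terminal f h]
    · simp [approx, h]
  | succ k ih => exact SubDist.expect_mono _ ih

theorem monotone_approx {A : Type*} (R : PARS A) (f : A → ℝ≥0∞) (a : A) :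
    Monotone fun k => R.approx f k a :=
  monotone_nat_of_le_succ fun k => R.approx_le_succ f k a

/-- `reduction` adds a step at its end, whereas `approx` peels one off at its beginning. The
induction hands the last step of the reduction over to the approximant, which is why `j` must vary;
the case `j = 0` is the one used later. -/
theorem expect_reduction {A : Type*} (R : PARS A) (f : A → ℝ≥0∞) (a : A) (k j : ℕ) :
    (R.reduction a k).expect (R.approx f j) = R.approx f (j + k) a := by
  induction k generalizing j with
  | zero => exact SubDist.expect_dirac a _
  | succ k ih =>
    rw [reduction, SubDist.expect_comb]
    refine (ih (j + 1)).trans ?_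
    rw [add_right_comm, add_assoc]

theorem nf_prob_of_terminal {A : Type*} {R : PARS A} (hR : R.Deterministic) (a : A) {b : A}
    (hb : R.Terminal b) : (R.nf hR a).prob b = ⨆ k, (R.reduction a k).prob b := by
  obtain ⟨δ, c, hred, hlim, -⟩ := R.isTerminalDist_nf hR a
  have h := hlim b hb
  rw [hred.eq_reduction hR] at h
  exact tendsto_nhds_unique h (tendsto_atTop_iSup (monotone_reduction a hb))

theorem wp_eq_iSup {A : Type*} {R : PARS A} (hR : R.Deterministic) (f : A → ℝ≥0∞) (a : A) :
    R.wp hR f a = ⨆ k, R.approx f k a := by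
  -- `approx f 0` is `f` cut off to terminal objects. The cut-off removes the non-terminal mass of
  -- the reduction, which need not be monotone in `k` and does not count in `nf`.
  have key : ∀ b, (R.nf hR a).prob b * f b
      = ⨆ k, (R.reduction a k).prob b * R.approx f 0 b := by
    intro b
    by_cases hb : R.Terminal b
    · rw [nf_prob_of_terminal hR a hb, ENNReal.iSup_mul, approx_of_terminal f hb]
    · obtain ⟨δ, c, -, -, hzero⟩ := R.isTerminalDist_nf hR a
      simp [hzero b hb, approx, hb]
  have hmono : ∀ b, Monotone fun k => (R.reduction a k).prob b * R.approx f 0 b := by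
    intro b
    by_cases hb : R.Terminal b
    · exact fun _ _ h => mul_le_mul_left (monotone_reduction a hb h) _
    · simp [approx, hb, monotone_const]
  rw [wp, SubDist.expect, tsum_congr key, ENNReal.tsum_iSup_of_monotone hmono]
  refine iSup_congr fun k => ?_
  refine (R.expect_reduction f a k 0).trans ?_
  rw [zero_add]

theorem approx_le_wp {A : Type*} {R : PARS A} (hR : R.Deterministic) (f : A → ℝ≥0∞) (k : ℕ)
    (a : A) : R.approx f k a ≤ R.wp hR f a := by
  rw [wp_eq_iSup]
  exact le_iSup (fun k => R.approx f k a) k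

theorem wp_of_terminal {A : Type*} {R : PARS A} (hR : R.Deterministic) (f : A → ℝ≥0∞) {a : A}
    (h : R.Terminal a) : R.wp hR f a = f a := by
  simp [wp_eq_iSup, approx_of_terminal f h]

theorem wp_of_step {A : Type*} {R : PARS A} (hR : R.Deterministic) (f : A → ℝ≥0∞) {a : A}
    {δ : SubDist A} (h : R a δ) : R.wp hR f a = δ.expect (R.wp hR f) := by
  have hw : R.wp hR f = fun a => ⨆ k, R.approx f k a := funext (wp_eq_iSup hR f)
  rw [hw, SubDist.expect_iSup _ (R.monotone_approx f)]
  beta_reduce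
  -- Dropping the stage `0` does not change an increasing supremum, and every later stage begins
  -- with the step to `δ`.
  rw [← (R.monotone_approx f a).iSup_nat_add 1]
  simp only [approx, next_of_step hR h]

/-- The weakest pre-expectation is below every function that dominates `f` on terminal objects and
does not increase in expectation along reductions. -/
theorem wp_le {A : Type*} {R : PARS A} (hR : R.Deterministic) {f F : A → ℝ≥0∞}
    (hterm : ∀ a, R.Terminal a → f a ≤ F a) (hstep : ∀ a δ, R a δ → δ.expect F ≤ F a) (a : A) :
    R.wp hR f a ≤ F a := by
  rw [wp_eq_iSup]
  refine iSup_le fun k => ?_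
  induction k generalizing a with
  | zero =>
    by_cases h : R.Terminal a
    · rw [approx_of_terminal f h]
      exact hterm a h
    · simp [approx, h]
  | succ k ih =>
    by_cases h : R.Terminal a
    · rw [approx_of_terminal f h]
      exact hterm a h
    · obtain ⟨δ, hδ⟩ : ∃ δ, R a δ := by simpa [Terminal] using h
      rw [approx, next_of_step hR hδ]
      exact (SubDist.expect_mono δ ih).trans (hstep a δ hδ)

end PARS

/-! ### The equations for `qwp` of each statement. -/

namespace QProg

variable {G : GateSet} {B V : Type*} {n : ℕ}

/-- The weakest pre-expectation of `f` at a configuration. -/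
noncomputable def confWp (f : State B V n → ℝ≥0∞) : Conf G B V n → ℝ≥0∞ :=
  PARS.wp Step step_deterministic fun μ => f μ.2

theorem confWp_none (f : State B V n → ℝ≥0∞) (σ : State B V n) :
    confWp (G := G) f (none, σ) = f σ :=
  PARS.wp_of_terminal _ _ ((terminal_step_iff _).2 rfl)

theorem confWp_of_step (f : State B V n → ℝ≥0∞) {μ : Conf G B V n} {δ : SubDist (Conf G B V n)}
    (h : Step μ δ) : confWp f μ = δ.expect (confWp f) :=
  PARS.wp_of_step _ _ h

theorem qwp_of_step_dirac (f : State B V n → ℝ≥0∞) {c : Stmt G B V n} {σ : State B V n}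
    {μ : Conf G B V n} (h : Step (some c, σ) (.dirac μ)) : qwp c f σ = confWp f μ :=
  (confWp_of_step f h).trans (SubDist.expect_dirac _ _)

theorem exists_step (c : Stmt G B V n) (σ : State B V n) : ∃ δ, Step (some c, σ) δ := by
  by_contra! h
  exact Option.some_ne_none c ((terminal_step_iff (some c, σ)).1 h)

/-- An upper bound for the truncated expectations of `c₁; c`, given one for those of `c`. -/
theorem approx_seqC_le (c : Stmt G B V n) (f g : State B V n → ℝ≥0∞) (k : ℕ)
    (hg : ∀ j ≤ k, (∀ i < j, ∀ μ : Conf G B V n,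
        PARS.approx Step (fun μ => f μ.2) i (some (seqC μ.1 c), μ.2) ≤ confWp g μ) →
      ∀ σ, PARS.approx Step (fun μ : Conf G B V n => f μ.2) j (some c, σ) ≤ g σ)
    (μ : Conf G B V n) :
    PARS.approx Step (fun μ => f μ.2) k (some (seqC μ.1 c), μ.2) ≤ confWp g μ := by
  -- The premise inside `hg` is the conclusion at smaller step counts. Composition ignores it; a
  -- loop needs it, because after one unfolding its own continuation is again the loop, with fewer
  -- steps left.
  induction k using Nat.strong_induction_on generalizing μ with
  | _ k ih =>
    obtain ⟨_ | c₁, s, ρ⟩ := μ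
    · rw [confWp_none]
      exact hg k le_rfl (fun i hi μ => ih i hi (fun j hj => hg j (hj.trans hi.le)) μ) (s, ρ)
    · cases k with
      | zero => simp [PARS.approx, terminal_step_iff]
      | succ k =>
        -- Both sides move along the same `δ`: the composite steps to its image under `seqC`, and
        -- one step of the budget is spent.
        obtain ⟨δ, hδ⟩ := exists_step c₁ (s, ρ)
        rw [PARS.approx, confWp_of_step g hδ]
        simp only [seqC]
        rw [PARS.next_of_step step_deterministic (Step.seq c₁ c s ρ δ hδ), SubDist.expect_map]
        exact SubDist.expect_mono _ fun μ =>
          ih k k.lt_succ_self (fun j hj => hg j (hj.trans k.le_succ)) μ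

theorem qwp_seq (c₁ c₂ : Stmt G B V n) (f : State B V n → ℝ≥0∞) :
    qwp (.seq c₁ c₂) f = qwp c₁ (qwp c₂ f) := by
  funext σ
  refine le_antisymm ?_ ?_
  · rw [qwp, PARS.wp_eq_iSup]
    exact iSup_le fun k => approx_seqC_le c₂ f (qwp c₂ f) k
      (fun j _ _ σ => PARS.approx_le_wp step_deterministic _ j _) (some c₁, σ)
  · refine PARS.wp_le step_deterministic
      (F := fun μ : Conf G B V n => confWp f (some (seqC μ.1 c₂), μ.2)) ?_ ?_ (some c₁, σ)
    · rintro ⟨c, σ⟩ h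
      obtain rfl : c = none := (terminal_step_iff _).1 h
      exact le_rfl
    · rintro ⟨_ | c, s, ρ⟩ δ hδ
      · cases hδ
      -- `F` is even invariant under steps, since `c; c₂` steps exactly as `c` does.
      · refine ge_of_eq ((confWp_of_step f (Step.seq c c₂ s ρ δ hδ)).trans ?_)
        rw [SubDist.expect_map]
        rfl

theorem qwp_ite (b : BExp B V) (c₁ c₂ : Stmt G B V n) (f : State B V n → ℝ≥0∞) :
    qwp (.ite b c₁ c₂) f = mix (guard b) (qwp c₁ f) (qwp c₂ f) := by
  funext ⟨s, ρ⟩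
  cases hb : b.eval s
  · rw [qwp_of_step_dirac f (.iteFalse b c₁ c₂ s ρ hb)]
    simp [mix, guard, hb, qwp, confWp]
  · rw [qwp_of_step_dirac f (.iteTrue b c₁ c₂ s ρ hb)]
    simp [mix, guard, hb, qwp, confWp]

theorem qwp_loop_unfold (b : BExp B V) (c : Stmt G B V n) (f : State B V n → ℝ≥0∞) :
    mix (guard b) (qwp c (qwp (.loop b c) f)) f = qwp (.loop b c) f := by
  funext ⟨s, ρ⟩
  cases hb : b.eval s
  · rw [qwp_of_step_dirac f (.loopFalse b c s ρ hb), confWp_none]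
    simp [mix, guard, hb]
  · rw [qwp_of_step_dirac f (.loopTrue b c s ρ hb), ← qwp_seq]
    simp [mix, guard, hb, qwp, confWp]

/-- Induction rule for loops. -/
theorem qwp_loop_le (b : BExp B V) (c : Stmt G B V n) {f g : State B V n → ℝ≥0∞}
    (hg : mix (guard b) (qwp c g) f ≤ g) : qwp (.loop b c) f ≤ g := by
  intro σ
  -- Reading the loop as `↓; loop` puts the goal in the form of `approx_seqC_le`, at the
  -- configuration `(none, σ)`.
  rw [qwp, PARS.wp_eq_iSup, ← confWp_none (G := G) g]
  refine iSup_le fun k => approx_seqC_le (.loop b c) f g k ?_ (none, σ)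
  rintro (_ | j) - ih ⟨s, ρ⟩
  · simp [PARS.approx, terminal_step_iff]
  · refine le_trans ?_ (hg (s, ρ))
    rw [PARS.approx]
    cases hb : b.eval s
    · rw [PARS.next_of_step step_deterministic (Step.loopFalse b c s ρ hb), SubDist.expect_dirac,
        PARS.approx_of_terminal _ ((terminal_step_iff _).2 rfl)]
      simp [mix, guard, hb]
    · rw [PARS.next_of_step step_deterministic (Step.loopTrue b c s ρ hb), SubDist.expect_dirac]
      -- The unfolded statement is `c` followed by the loop, so the premise at `j` bounds it by `qwp
      -- c g`, the true branch of the functional at `g`.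
      refine (ih j j.lt_succ_self (some c, s, ρ)).trans ?_
      simp [mix, guard, hb, qwp, confWp]

/-- The two outcome probabilities add up to `1`; they are finite, so the truncated subtraction is
exact. -/
theorem one_sub_outcomeProb_false (i : Fin n) (σ : State B V n) :
    1 - outcomeProb false i σ = measProb true i σ.2 := by
  have h := tsum_measProb i σ.2
  rw [tsum_bool] at h
  rw [outcomeProb, trace_measMat_conj, ← h]
  exact ENNReal.add_sub_cancel_left ENNReal.ofReal_ne_top

theorem qwp_meas (x : B) (i : Fin n) (f : State B V n → ℝ≥0∞) :
    qwp (G := G) (.meas x i) f = mix (outcomeProb false i)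
      (fun σ => f (σ.1.setB x false, postMeas false i σ.2))
      (fun σ => f (σ.1.setB x true, postMeas true i σ.2)) := by
  funext ⟨s, ρ⟩
  refine (confWp_of_step f (.meas x i s ρ)).trans ?_
  rw [SubDist.expect_comb, tsum_bool]
  simp only [SubDist.expect_dirac, confWp_none, mix, one_sub_outcomeProb_false]
  rw [outcomeProb, trace_measMat_conj, measProb]

end QProg

/-! ### Adequacy by structural induction. -/

theorem mainTheorem4 {G : QProg.GateSet} {B V : Type*} {n : ℕ}
    (c : QProg.Stmt G B V n) (f : QProg.State B V n → ENNReal) :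
    QProg.qwp c f = QProg.qet c f := by
  induction c generalizing f with
  | skip =>
    funext ⟨s, ρ⟩
    exact (QProg.qwp_of_step_dirac f (.skip s ρ)).trans (QProg.confWp_none f _)
  | assignB x e =>
    funext ⟨s, ρ⟩
    exact (QProg.qwp_of_step_dirac f (.assignB x e s ρ)).trans (QProg.confWp_none f _)
  | assignN x e =>
    funext ⟨s, ρ⟩
    exact (QProg.qwp_of_step_dirac f (.assignN x e s ρ)).trans (QProg.confWp_none f _)
  | seq c₁ c₂ ih₁ ih₂ =>
    rw [QProg.qwp_seq, ih₂, ih₁]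
    rfl
  | ite b c₁ c₂ ih₁ ih₂ =>
    rw [QProg.qwp_ite, ih₁, ih₂]
    rfl
  | loop b c ih =>
    -- The induction hypothesis is used at the least fixed point in one direction and at `qwp` of
    -- the loop in the other, hence the generalization over `f`.
    refine le_antisymm (QProg.qwp_loop_le b c ?_) (OrderHom.lfp_le_fixed _ ?_)
    · rw [ih]
      exact ((QProg.loopFun b (QProg.qet c) f).map_lfp).le
    · refine Eq.trans ?_ (QProg.qwp_loop_unfold b c f)
      rw [ih]
      rfl
  | apply g q =>
    funext ⟨s, ρ⟩
    exact (QProg.qwp_of_step_dirac f (.apply g q s ρ)).trans (QProg.confWp_none f _)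
  | meas x i =>
    exact QProg.qwp_meas x i f
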